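/- Let $\mathcal{B}$ be a complete Boolean algebra and let $Q$ be its Stone space (a compact, extremally disconnected Hausdorff space). Let $C(Q)$ be the algebra of continuous functions $Q\to\mathbb{R}$, and let $L^0(\mathcal{B})=C_\infty(Q)$ be the set of continuous functions $x\colon Q\to[-\infty,+\infty]$ that take the values $\pm\infty$ at most on a nowhere dense set. With the pointwise order, and with the algebraic operations that extend by continuity the pointwise ones from the dense open sets where all the functions involved are finite, $L^0(\mathcal{B})$ is a real commutative algebra and a vector lattice containing $C(Q)$. An element $e\in\mathcal{B}$ is identified with the characteristic function of the corresponding clopen subset of $Q$; the elements of $\mathcal{B}$ are in this way exactly the idempotents of $L^0(\mathcal{B})$, and $\mathbf{1}$ is the constant function one. Theorem. Let $\delta\colon C(Q)\to L^0(\mathcal{B})$ be a non-zero derivation, that is, an $\mathbb{R}$-linear map, not identically zero, such that $\delta(xy)=\delta(x)y+x\delta(y)$ for all $x,y\in C(Q)$. Then there exist a sequence $(a_n)_{n\in\mathbb{N}}$ in $C(Q)$ and a non-zero idempotent $q\in\mathcal{B}$ such that $|a_n|\leqslant\mathbf{1}$ and $|\delta(a_n)|\geqslant nq$ for all $n\in\mathbb{N}$.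 -/

import Mathlib

open Set Topology TopologicalSpace

universe u

/-! ### The Stone space of a Boolean algebra -/

/-- The Stone space of a Boolean algebra `B`: its points are the ultrafilters of `B`, given as the
Boolean homomorphisms from `B` to the two-element algebra. -/
def StoneSpace (B : Type u) [BooleanAlgebra B] : Type u := BoundedLatticeHom B Bool

namespace StoneSpace

section Boolean

variable {B : Type u} [BooleanAlgebra B]

/-- The value of the point `t` (a homomorphism to `Bool`) at the element `e`. -/
noncomputable def eval (t : StoneSpace B) (e : B) : Bool := BoundedLatticeHom.toLatticeHom t e

/-- The Stone topology is the topology of pointwise convergence; a base of it is formed by the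
sets `{t | t.eval e = true}`. -/
noncomputable instance : TopologicalSpace (StoneSpace B) :=
  TopologicalSpace.induced (fun (t : StoneSpace B) (e : B) => t.eval e) inferInstance

/-- The set `Q(e)` of the ultrafilters that contain `e`. -/
def basic (e : B) : Set (StoneSpace B) := {t | t.eval e = true}

theorem eval_bot (t : StoneSpace B) : t.eval ⊥ = false := BoundedLatticeHom.map_bot' t

theorem eval_top (t : StoneSpace B) : t.eval ⊤ = true := BoundedLatticeHom.map_top' t

theorem eval_inf (t : StoneSpace B) (a b : B) : t.eval (a ⊓ b) = (t.eval a && t.eval b) :=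
  map_inf (BoundedLatticeHom.toLatticeHom t) a b

theorem eval_sup (t : StoneSpace B) (a b : B) : t.eval (a ⊔ b) = (t.eval a || t.eval b) :=
  map_sup (BoundedLatticeHom.toLatticeHom t) a b

theorem eval_compl (t : StoneSpace B) (a : B) : t.eval aᶜ = !(t.eval a) := by
  have h1 := t.eval_inf a aᶜ
  have h2 := t.eval_sup a aᶜ
  rw [inf_compl_eq_bot, eval_bot] at h1
  rw [sup_compl_eq_top, eval_top] at h2
  revert h1 h2
  cases t.eval a <;> cases t.eval aᶜ <;> simp

theorem eval_mono (t : StoneSpace B) {a b : B} (h : a ≤ b) (ha : t.eval a = true) :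
    t.eval b = true := by
  have h1 := t.eval_inf a b
  rw [inf_eq_left.2 h, ha] at h1
  simpa using h1.symm

theorem eval_injective :
    Function.Injective (fun (t : StoneSpace B) (e : B) => t.eval e) := by
  intro s t h
  exact DFunLike.ext (F := BoundedLatticeHom B Bool) s t (fun e => congrFun h e)

theorem isEmbedding_eval : IsEmbedding (fun (t : StoneSpace B) (e : B) => t.eval e) :=
  ⟨⟨rfl⟩, eval_injective⟩

theorem continuous_eval (e : B) : Continuous (fun t : StoneSpace B => t.eval e) :=
  (continuous_apply e).comp isEmbedding_eval.continuous

theorem isClopen_basic (e : B) : IsClopen (basic e) :=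
  (isClopen_discrete ({true} : Set Bool)).preimage (continuous_eval e)

instance : T2Space (StoneSpace B) := isEmbedding_eval.t2Space

theorem isClosed_range_eval :
    IsClosed (range (fun (t : StoneSpace B) (e : B) => t.eval e)) := by
  have : range (fun (t : StoneSpace B) (e : B) => t.eval e)
      = {f : B → Bool | f ⊥ = false} ∩ {f | f ⊤ = true}
        ∩ (⋂ a, ⋂ b, {f | f (a ⊓ b) = (f a && f b)})
        ∩ (⋂ a, ⋂ b, {f | f (a ⊔ b) = (f a || f b)}) := by
    ext f
    constructor
    · rintro ⟨t, rfl⟩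
      simp only [mem_inter_iff, mem_ofPred_eq, mem_iInter]
      exact ⟨⟨⟨t.eval_bot, t.eval_top⟩, t.eval_inf⟩, t.eval_sup⟩
    · simp only [mem_inter_iff, mem_ofPred_eq, mem_iInter]
      rintro ⟨⟨⟨h0, h1⟩, h2⟩, h3⟩
      exact ⟨(⟨⟨⟨f, h3⟩, h2⟩, h1, h0⟩ : BoundedLatticeHom B Bool), rfl⟩
  rw [this]
  have c2 : Continuous (fun p : Bool × Bool => (p.1 && p.2)) := continuous_of_discreteTopology
  have c3 : Continuous (fun p : Bool × Bool => (p.1 || p.2)) := continuous_of_discreteTopology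
  refine IsClosed.inter (IsClosed.inter (IsClosed.inter ?_ ?_) ?_) ?_
  · exact isClosed_eq (continuous_apply _) continuous_const
  · exact isClosed_eq (continuous_apply _) continuous_const
  · exact isClosed_iInter fun a => isClosed_iInter fun b => isClosed_eq (continuous_apply _)
      (c2.comp₂ (continuous_apply a) (continuous_apply b))
  · exact isClosed_iInter fun a => isClosed_iInter fun b => isClosed_eq (continuous_apply _)
      (c3.comp₂ (continuous_apply a) (continuous_apply b))

instance : CompactSpace (StoneSpace B) :=
  IsClosedEmbedding.compactSpace ⟨isEmbedding_eval, isClosed_range_eval⟩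

/-- The sets `Q(e)` form a base of the topology. -/
theorem exists_basic_subset {U : Set (StoneSpace B)} (hU : IsOpen U) {t : StoneSpace B}
    (ht : t ∈ U) : ∃ e : B, t ∈ basic e ∧ basic e ⊆ U := by
  obtain ⟨V, hV, rfl⟩ := isOpen_induced_iff.1 hU
  obtain ⟨I, v, hv, hIV⟩ := isOpen_pi_iff.1 hV _ ht
  classical
  refine ⟨I.inf (fun a => if t.eval a = true then a else aᶜ), ?_, ?_⟩
  · show t.eval _ = true
    clear hIV hv
    induction I using Finset.induction_on with
    | empty => simpa using t.eval_top
    | insert a s _ ih =>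
      rw [Finset.inf_insert, eval_inf, ih, Bool.and_true]
      split_ifs with h
      · exact h
      · rw [eval_compl]; simpa using h
  · intro s hs
    apply hIV
    intro a ha
    have h1 : s.eval (if t.eval a = true then a else aᶜ) = true :=
      s.eval_mono (Finset.inf_le (f := fun a => if t.eval a = true then a else aᶜ) ha) hs
    have h2 : s.eval a = t.eval a := by
      split_ifs at h1 with h
      · rw [h1, h]
      · rw [eval_compl] at h1
        revert h h1
        cases s.eval a <;> cases t.eval a <;> simp
    show s.eval a ∈ v a
    rw [h2]
    exact (hv a ha).2

/-- Every non-zero element belongs to an ultrafilter. -/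
theorem basic_nonempty {e : B} (he : e ≠ ⊥) : (basic e).Nonempty := by
  have hd : Disjoint ((Order.PFilter.principal e : Order.PFilter B) : Set B)
      ((Order.Ideal.principal ⊥ : Order.Ideal B) : Set B) := by
    rw [Set.disjoint_left]
    intro x hx hx'
    have h1 : e ≤ x := Order.PFilter.mem_principal.1 hx
    have h2 : x ≤ ⊥ := Order.Ideal.mem_principal.1 hx'
    exact he (le_bot_iff.1 (h1.trans h2))
  obtain ⟨J, hJ, -, hd⟩ := DistribLattice.prime_ideal_of_disjoint_filter_ideal hd
  classical
  have heJ : e ∉ J := fun h =>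
    Set.disjoint_left.1 hd (Order.PFilter.mem_principal.2 le_rfl) h
  have htop : (⊤ : B) ∉ J := fun h => heJ (J.lower le_top h)
  refine ⟨(⟨⟨⟨fun x => decide (x ∉ J), fun a b => ?_⟩, fun a b => ?_⟩, ?_, ?_⟩ :
    BoundedLatticeHom B Bool), ?_⟩
  · have : a ⊔ b ∈ J ↔ a ∈ J ∧ b ∈ J := Order.Ideal.sup_mem_iff
    by_cases ha : a ∈ J <;> by_cases hb : b ∈ J <;> simp [this, ha, hb]
  · have : a ⊓ b ∈ J ↔ a ∈ J ∨ b ∈ J :=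
      ⟨fun h => hJ.mem_or_mem h, fun h => h.elim (J.lower inf_le_left) (J.lower inf_le_right)⟩
    by_cases ha : a ∈ J <;> by_cases hb : b ∈ J <;> simp [this, ha, hb]
  · simpa using htop
  · simp
  · show decide (e ∉ J) = true
    simpa using heJ

end Boolean

/-- The Stone space of a complete Boolean algebra is extremally disconnected. -/
instance {B : Type u} [CompleteBooleanAlgebra B] : ExtremallyDisconnected (StoneSpace B) where
  open_closure U hU := by
    have key : closure U = basic (sSup {e : B | basic e ⊆ U}) := by
      apply Subset.antisymm
      · refine closure_minimal (fun t ht => ?_) (isClopen_basic _).isClosed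
        obtain ⟨e, hte, heU⟩ := exists_basic_subset hU ht
        exact t.eval_mono (le_sSup heU) hte
      · intro t ht
        rw [mem_closure_iff]
        intro V hV htV
        obtain ⟨f, htf, hfV⟩ := exists_basic_subset hV htV
        have hne : f ⊓ sSup {e : B | basic e ⊆ U} ≠ ⊥ := by
          intro h0
          have h1 := t.eval_inf f (sSup {e : B | basic e ⊆ U})
          rw [h0, eval_bot] at h1
          rw [show t.eval f = true from htf,
            show t.eval (sSup {e : B | basic e ⊆ U}) = true from ht] at h1
          simp at h1
        have : ∃ e : B, basic e ⊆ U ∧ f ⊓ e ≠ ⊥ := by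
          by_contra! hcon
          apply hne
          rw [inf_sSup_eq]
          simpa using hcon
        obtain ⟨e, heU, hfe⟩ := this
        obtain ⟨s, hs⟩ := basic_nonempty hfe
        exact ⟨s, hfV (s.eval_mono inf_le_left hs), heU (s.eval_mono inf_le_right hs)⟩
    rw [key]
    exact (isClopen_basic _).isOpen

end StoneSpace

/-! ### The algebra of extended continuous functions -/

/-- `CInfty Q`: the continuous functions `Q → [-∞, +∞]` that take the values `±∞` at most on a
nowhere dense set. -/
structure CInfty (Q : Type u) [TopologicalSpace Q] where
  toFun : Q → EReal
  continuous_toFun : Continuous toFun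
  isNowhereDense_infinite : IsNowhereDense {t | toFun t = ⊤ ∨ toFun t = ⊥}

namespace CInfty

noncomputable section

section Basic

theorem infinite_eq_compl {Q : Type u} (f : Q → EReal) :
    {t | f t = ⊤ ∨ f t = ⊥} = {t | ∃ r : ℝ, f t = (r : EReal)}ᶜ := by
  ext t
  simp only [mem_ofPred_eq, mem_compl_iff]
  induction f t <;> simp

variable {Q : Type u} [TopologicalSpace Q]

instance : CoeFun (CInfty Q) (fun _ => Q → EReal) := ⟨toFun⟩

theorem coe_injective : Function.Injective (fun (x : CInfty Q) => (x : Q → EReal)) := by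
  rintro ⟨f, _, _⟩ ⟨g, _, _⟩ h
  cases h
  rfl

/-- The set of the points at which `x` is finite. -/
def finiteSet (x : CInfty Q) : Set Q := {t | ∃ r : ℝ, x t = (r : EReal)}

theorem isOpen_finite_of_continuous {f : Q → EReal} (hf : Continuous f) :
    IsOpen {t | ∃ r : ℝ, f t = (r : EReal)} := by
  rw [← isClosed_compl_iff, ← infinite_eq_compl]
  exact (isClosed_eq hf continuous_const).union (isClosed_eq hf continuous_const)

theorem isOpen_finiteSet (x : CInfty Q) : IsOpen x.finiteSet :=
  isOpen_finite_of_continuous x.continuous_toFun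

theorem dense_finiteSet (x : CInfty Q) : Dense x.finiteSet := by
  have h := x.isNowhereDense_infinite
  rw [infinite_eq_compl,
    (isOpen_finite_of_continuous x.continuous_toFun).isClosed_compl.isNowhereDense_iff,
    interior_eq_empty_iff_dense_compl, compl_compl] at h
  exact h

/-- A continuous function that is finite on a dense set belongs to `CInfty Q`. -/
def ofDense (f : Q → EReal) (hf : Continuous f) (h : Dense {t | ∃ r : ℝ, f t = (r : EReal)}) :
    CInfty Q where
  toFun := f
  continuous_toFun := hf
  isNowhereDense_infinite := by
    rw [infinite_eq_compl, (isOpen_finite_of_continuous hf).isClosed_compl.isNowhereDense_iff,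
      interior_eq_empty_iff_dense_compl, compl_compl]
    exact h

/-- Elements of `CInfty Q` that agree on a dense set are equal. -/
theorem ext_of_dense {x y : CInfty Q} {U : Set Q} (hU : Dense U) (h : ∀ t ∈ U, x t = y t) :
    x = y :=
  coe_injective (Continuous.ext_on hU x.continuous_toFun y.continuous_toFun h)

theorem dense_inter (x y : CInfty Q) : Dense (x.finiteSet ∩ y.finiteSet) :=
  x.dense_finiteSet.inter_of_isOpen_left y.dense_finiteSet x.isOpen_finiteSet

/-- Constants, more generally real continuous functions, as elements of `CInfty Q`. -/
def ofC (a : C(Q, ℝ)) : CInfty Q :=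
  ofDense (fun t => ((a t : ℝ) : EReal)) (continuous_coe_real_ereal.comp a.continuous)
    (by
      have : {t | ∃ r : ℝ, ((a t : ℝ) : EReal) = (r : EReal)} = univ :=
        eq_univ_of_forall fun t => ⟨a t, rfl⟩
      rw [this]
      exact dense_univ)

theorem ofC_apply (a : C(Q, ℝ)) (t : Q) : ofC a t = ((a t : ℝ) : EReal) := rfl

/-- The order of `CInfty Q` is the pointwise one. -/
instance : PartialOrder (CInfty Q) :=
  PartialOrder.lift (fun x => (x : Q → EReal)) coe_injective

theorem le_def (x y : CInfty Q) : x ≤ y ↔ ∀ t, x t ≤ y t := Iff.rfl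

/-- The lattice operations of `CInfty Q` are the pointwise ones. -/
instance : Lattice (CInfty Q) where
  sup x y := ofDense (fun t => max (x t) (y t)) (x.continuous_toFun.max y.continuous_toFun)
    ((dense_inter x y).mono (by
      rintro t ⟨⟨r, hr⟩, ⟨s, hs⟩⟩
      exact ⟨max r s, by rw [hr, hs]; exact (EReal.coe_strictMono.monotone.map_max).symm⟩))
  le_sup_left _ _ _ := le_max_left _ _
  le_sup_right _ _ _ := le_max_right _ _
  sup_le _ _ _ h1 h2 t := max_le (h1 t) (h2 t)
  inf x y := ofDense (fun t => min (x t) (y t)) (x.continuous_toFun.min y.continuous_toFun)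
    ((dense_inter x y).mono (by
      rintro t ⟨⟨r, hr⟩, ⟨s, hs⟩⟩
      exact ⟨min r s, by rw [hr, hs]; exact (EReal.coe_strictMono.monotone.map_min).symm⟩))
  inf_le_left _ _ _ := min_le_left _ _
  inf_le_right _ _ _ := min_le_right _ _
  le_inf _ _ _ h1 h2 t := le_min (h1 t) (h2 t)

theorem continuousOn_toReal (x : CInfty Q) :
    ContinuousOn (fun t => (x t).toReal) x.finiteSet := by
  refine EReal.continuousOn_toReal.comp x.continuous_toFun.continuousOn ?_
  rintro t ⟨r, hr⟩
  simp [hr]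

instance : Neg (CInfty Q) := ⟨fun x => ofDense (fun t => -x t)
  (continuous_neg.comp x.continuous_toFun)
  (x.dense_finiteSet.mono (by
    rintro t ⟨r, hr⟩
    exact ⟨-r, by rw [hr]; rfl⟩))⟩

instance : Zero (CInfty Q) := ⟨ofC 0⟩

instance : One (CInfty Q) := ⟨ofC 1⟩

theorem neg_apply (x : CInfty Q) (t : Q) : (-x) t = -x t := rfl

theorem zero_apply (t : Q) : (0 : CInfty Q) t = ((0 : ℝ) : EReal) := rfl

theorem one_apply (t : Q) : (1 : CInfty Q) t = ((1 : ℝ) : EReal) := rfl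

theorem ext₁ (x : CInfty Q) {a b : CInfty Q}
    (h : ∀ t, ∀ r : ℝ, x t = r → a t = b t) : a = b :=
  ext_of_dense x.dense_finiteSet fun t ⟨r, hr⟩ => h t r hr

theorem ext₂ (x y : CInfty Q) {a b : CInfty Q}
    (h : ∀ t, ∀ r s : ℝ, x t = r → y t = s → a t = b t) : a = b :=
  ext_of_dense (dense_inter x y) fun t ⟨⟨r, hr⟩, ⟨s, hs⟩⟩ => h t r s hr hs

theorem ext₃ (x y z : CInfty Q) {a b : CInfty Q}
    (h : ∀ t, ∀ r s u : ℝ, x t = r → y t = s → z t = u → a t = b t) : a = b :=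
  ext_of_dense ((dense_inter x y).inter_of_isOpen_left z.dense_finiteSet
    (x.isOpen_finiteSet.inter y.isOpen_finiteSet))
    fun t ⟨⟨⟨r, hr⟩, ⟨s, hs⟩⟩, ⟨u, hu⟩⟩ => h t r s u hr hs hu

end Basic

variable {Q : Type u} [TopologicalSpace Q] [CompactSpace Q] [T2Space Q] [ExtremallyDisconnected Q]

/-- In an extremally disconnected compact space, a real function that is continuous on a dense open
set extends from that set to an element of `CInfty Q`. -/
theorem exists_extension {U : Set Q} (hU : IsOpen U) (hUd : Dense U) {f : Q → ℝ}
    (hf : ContinuousOn f U) : ∃ x : CInfty Q, ∀ t ∈ U, x t = (f t : EReal) := by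
  let F : Q → EReal := fun t => (f t : EReal)
  have hF : ContinuousOn F U := continuous_coe_real_ereal.comp_continuousOn hf
  let G : Set (Q × EReal) := closure ((fun t => (t, F t)) '' U)
  have hGc : CompactSpace G := isCompact_iff_compactSpace.1 isClosed_closure.isCompact
  let π : G → Q := fun p => p.1.1
  have hπ : Continuous π := continuous_fst.comp continuous_subtype_val
  have hs : Function.Surjective π := by
    have h1 : IsClosed (range π) := (isCompact_range hπ).isClosed
    have h2 : U ⊆ range π := fun t ht => ⟨⟨(t, F t), subset_closure ⟨t, ht, rfl⟩⟩, rfl⟩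
    have h3 : range π = univ := (hUd.mono h2).closure_eq ▸ h1.closure_eq.symm
    exact range_eq_univ.1 h3
  obtain ⟨h, hc, hh⟩ := CompactT2.ExtremallyDisconnected.projective (A := Q)
    (continuous_id (X := Q)) hπ hs
  have hval : ∀ t ∈ U, (h t).1.2 = F t := by
    intro t ht
    have hfst : (h t).1.1 = t := congrFun hh t
    have hFt : Filter.Tendsto F (𝓝 t) (𝓝 (F t)) := hF.continuousAt (hU.mem_nhds ht)
    by_contra hne
    obtain ⟨V, W, hV, hW, hV1, hW1, hVW⟩ := t2_separation hne
    have hN : F ⁻¹' W ∈ 𝓝 t := hFt (hW.mem_nhds hW1)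
    obtain ⟨N, hNW, hNo, htN⟩ := mem_nhds_iff.1 hN
    obtain ⟨p, ⟨hp1, hp2⟩, s, -, rfl⟩ := mem_closure_iff.1 (h t).2 (N ×ˢ V) (hNo.prod hV)
      ⟨by rw [hfst]; exact htN, hV1⟩
    exact Set.disjoint_left.1 hVW hp2 (hNW hp1)
  refine ⟨ofDense (fun t => (h t).1.2)
    (continuous_snd.comp (continuous_subtype_val.comp hc))
    (hUd.mono fun t ht => ⟨f t, hval t ht⟩), hval⟩

theorem exists_add (x y : CInfty Q) : ∃ z : CInfty Q, ∀ t ∈ x.finiteSet ∩ y.finiteSet,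
    z t = (((x t).toReal + (y t).toReal : ℝ) : EReal) :=
  exists_extension (x.isOpen_finiteSet.inter y.isOpen_finiteSet) (dense_inter x y)
    ((x.continuousOn_toReal.mono inter_subset_left).add
      (y.continuousOn_toReal.mono inter_subset_right))

theorem exists_mul (x y : CInfty Q) : ∃ z : CInfty Q, ∀ t ∈ x.finiteSet ∩ y.finiteSet,
    z t = (((x t).toReal * (y t).toReal : ℝ) : EReal) :=
  exists_extension (x.isOpen_finiteSet.inter y.isOpen_finiteSet) (dense_inter x y)
    ((x.continuousOn_toReal.mono inter_subset_left).mul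
      (y.continuousOn_toReal.mono inter_subset_right))

/-- The sum is the unique element of `CInfty Q` that is equal to the pointwise sum wherever both
summands are finite. -/
instance : Add (CInfty Q) := ⟨fun x y => (exists_add x y).choose⟩

/-- The product is the unique element of `CInfty Q` that is equal to the pointwise product wherever
both factors are finite. -/
instance : Mul (CInfty Q) := ⟨fun x y => (exists_mul x y).choose⟩

theorem add_apply {x y : CInfty Q} {t : Q} {r s : ℝ} (hx : x t = r) (hy : y t = s) :
    (x + y) t = ((r + s : ℝ) : EReal) := by
  have h := (exists_add x y).choose_spec t ⟨⟨r, hx⟩, ⟨s, hy⟩⟩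
  rw [hx, hy] at h
  exact h

theorem mul_apply {x y : CInfty Q} {t : Q} {r s : ℝ} (hx : x t = r) (hy : y t = s) :
    (x * y) t = ((r * s : ℝ) : EReal) := by
  have h := (exists_mul x y).choose_spec t ⟨⟨r, hx⟩, ⟨s, hy⟩⟩
  rw [hx, hy] at h
  exact h

instance : CommRing (CInfty Q) where
  add_assoc x y z := ext₃ x y z fun t r s u hx hy hz => by
    rw [add_apply (add_apply hx hy) hz, add_apply hx (add_apply hy hz), add_assoc]
  zero_add x := ext₁ x fun t r hx => by rw [add_apply (zero_apply t) hx, zero_add, hx]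
  add_zero x := ext₁ x fun t r hx => by rw [add_apply hx (zero_apply t), add_zero, hx]
  add_comm x y := ext₂ x y fun t r s hx hy => by
    rw [add_apply hx hy, add_apply hy hx, add_comm]
  neg_add_cancel x := ext₁ x fun t r hx => by
    have h : (-x) t = ((-r : ℝ) : EReal) := by rw [neg_apply, hx]; rfl
    rw [add_apply h hx, neg_add_cancel, zero_apply]
  mul_assoc x y z := ext₃ x y z fun t r s u hx hy hz => by
    rw [mul_apply (mul_apply hx hy) hz, mul_apply hx (mul_apply hy hz), mul_assoc]
  one_mul x := ext₁ x fun t r hx => by rw [mul_apply (one_apply t) hx, one_mul, hx]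
  mul_one x := ext₁ x fun t r hx => by rw [mul_apply hx (one_apply t), mul_one, hx]
  mul_comm x y := ext₂ x y fun t r s hx hy => by
    rw [mul_apply hx hy, mul_apply hy hx, mul_comm]
  zero_mul x := ext₁ x fun t r hx => by
    rw [mul_apply (zero_apply t) hx, zero_mul, zero_apply]
  mul_zero x := ext₁ x fun t r hx => by
    rw [mul_apply hx (zero_apply t), mul_zero, zero_apply]
  left_distrib x y z := ext₃ x y z fun t r s u hx hy hz => by
    rw [mul_apply hx (add_apply hy hz), add_apply (mul_apply hx hy) (mul_apply hx hz), mul_add]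
  right_distrib x y z := ext₃ x y z fun t r s u hx hy hz => by
    rw [mul_apply (add_apply hx hy) hz, add_apply (mul_apply hx hz) (mul_apply hy hz), add_mul]
  nsmul := nsmulRec
  zsmul := zsmulRec

/-- The inclusion of the algebra `C(Q)` into `CInfty Q`. -/
def ofCHom : C(Q, ℝ) →+* CInfty Q where
  toFun := ofC
  map_zero' := rfl
  map_one' := rfl
  map_add' a b := coe_injective (funext fun t =>
    (add_apply (ofC_apply a t) (ofC_apply b t)).symm)
  map_mul' a b := coe_injective (funext fun t =>
    (mul_apply (ofC_apply a t) (ofC_apply b t)).symm)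

/-- `CInfty Q` is an algebra over its subalgebra `C(Q)`. -/
instance : Algebra C(Q, ℝ) (CInfty Q) := ofCHom.toAlgebra

/-- `CInfty Q` is an algebra over `ℝ`, the real numbers being the constant functions. -/
instance : Algebra ℝ (CInfty Q) := (ofCHom.comp (algebraMap ℝ C(Q, ℝ))).toAlgebra

instance : IsScalarTower ℝ C(Q, ℝ) (CInfty Q) := IsScalarTower.of_algebraMap_eq' rfl

end

end CInfty

/-- `L0 B` is `C_∞(Q)` for the Stone space `Q` of the complete Boolean algebra `B`. -/
abbrev L0 (B : Type u) [CompleteBooleanAlgebra B] : Type u := CInfty (StoneSpace B)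

open Classical in
/-- The element `e` of `B` as an idempotent of `L0 B`: the characteristic function of `Q(e)`. -/
noncomputable def L0.idem {B : Type u} [CompleteBooleanAlgebra B] (e : B) : L0 B :=
  CInfty.ofC ⟨fun t => if t ∈ StoneSpace.basic e then 1 else 0,
    continuous_const.if (fun _ ht => absurd ht (by
      show _ ∉ frontier (StoneSpace.basic e)
      rw [(StoneSpace.isClopen_basic e).frontier_eq]; exact notMem_empty _)) continuous_const⟩

/-! A derivation kills every idempotent, hence the subalgebra generated by the characteristic
functions of clopen sets. These separate the points of the Stone space, so by Stone–Weierstrass the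
kernel of `δ` is uniformly dense in `C(Q)` (`StoneSpace.exists_norm_sub_lt_of_derivation`). A
non-zero `δ` is therefore badly discontinuous: if `δ x ≠ 0`, subtracting a nearby kernel element `s`
makes `x - s` uniformly small while `δ (x - s) = δ x` stays fixed. Rescaling `x - s` to norm at most
one makes its image large wherever `δ x` is bounded away from zero, and
`L0.exists_lt_abs_of_ne_zero` provides a single `q` on which this holds, independent of `n`. -/

/-- A derivation vanishes at the idempotents. -/
theorem Derivation.map_eq_zero_of_mul_self {R A M : Type*} [CommRing R] [CommRing A] [Algebra R A]
    [AddCommGroup M] [Module R M] [Module A M] (δ : Derivation R A M) {e : A} (he : e * e = e) :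
    δ e = 0 := by
  have h1 : δ e = e • δ e + e • δ e := by
    rw [← δ.leibniz, he]
  -- Multiplying `δ e = 2 e δ e` by `e` gives `e δ e = 2 e δ e`.
  have h2 : e • δ e = 0 := by
    have h := congrArg (e • ·) h1
    simp only [smul_add, smul_smul, he] at h
    exact left_eq_add.1 h
  rw [h1, h2, add_zero]

/-- The elements at which a derivation vanishes form a subalgebra. -/
def Derivation.kerSubalgebra {R A M : Type*} [CommRing R] [CommRing A] [Algebra R A]
    [AddCommGroup M] [Module R M] [Module A M] (δ : Derivation R A M) : Subalgebra R A where
  carrier := {a | δ a = 0}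
  mul_mem' {a b} ha hb := by
    have ha : δ a = 0 := ha
    have hb : δ b = 0 := hb
    show δ (a * b) = 0
    rw [δ.leibniz, ha, hb, smul_zero, smul_zero, add_zero]
  add_mem' {a b} ha hb := by
    have ha : δ a = 0 := ha
    have hb : δ b = 0 := hb
    show δ (a + b) = 0
    rw [map_add, ha, hb, add_zero]
  algebraMap_mem' r := δ.map_algebraMap r

/-! ### Absolute values and real multiples at points of finiteness -/

namespace CInfty

section

variable {Q : Type u} [TopologicalSpace Q]

/-- Inequalities in `CInfty Q` may be checked on a dense set. -/
theorem le_of_dense {x y : CInfty Q} {U : Set Q} (hU : Dense U) (h : ∀ t ∈ U, x t ≤ y t) :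
    x ≤ y := by
  have hc : IsClosed {t | x t ≤ y t} := isClosed_le x.continuous_toFun y.continuous_toFun
  intro t
  have ht : t ∈ closure U := hU t
  exact closure_minimal (fun s hs => h s hs) hc ht

variable [CompactSpace Q] [T2Space Q] [ExtremallyDisconnected Q]

theorem abs_apply (x : CInfty Q) (t : Q) : |x| t = max (x t) (-x t) := rfl

theorem abs_apply_of_eq {x : CInfty Q} {t : Q} {r : ℝ} (hx : x t = r) :
    |x| t = ((|r| : ℝ) : EReal) := by
  rw [abs_apply, hx]
  exact (EReal.coe_strictMono.monotone.map_max).symm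

/-- A real scalar acts as multiplication by a constant function, which is finite everywhere; so
finiteness of `x` at `t` is all that the product formula needs. -/
theorem smul_apply (c : ℝ) {x : CInfty Q} {t : Q} {r : ℝ} (hx : x t = r) :
    (c • x) t = ((c * r : ℝ) : EReal) := by
  rw [Algebra.smul_def]
  exact mul_apply (ofC_apply (algebraMap ℝ C(Q, ℝ) c) t) hx

end

end CInfty

/-! ### Uniform density of the kernel of a derivation -/

namespace StoneSpace

variable {B : Type u} [BooleanAlgebra B]

/-- The characteristic function of `Q(e)`. -/
noncomputable def indicator (e : B) : C(StoneSpace B, ℝ) :=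
  ⟨fun t => if t.eval e = true then 1 else 0,
    (continuous_of_discreteTopology (f := fun b : Bool => if b = true then (1 : ℝ) else 0)).comp
      (continuous_eval e)⟩

theorem indicator_apply (e : B) (t : StoneSpace B) :
    indicator e t = if t.eval e = true then 1 else 0 := rfl

theorem indicator_mul_self (e : B) : indicator e * indicator e = indicator e := by
  ext t
  rw [ContinuousMap.mul_apply, indicator_apply]
  split_ifs <;> simp

/-- A subalgebra of `C(Q)` that contains the characteristic functions of the sets `Q(e)` separates
the points. -/
theorem separatesPoints_of_indicator_mem {A : Subalgebra ℝ C(StoneSpace B, ℝ)}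
    (hA : ∀ e : B, indicator e ∈ A) : A.SeparatesPoints := by
  intro s t hst
  -- A basic neighbourhood of `s` inside the complement of `{t}` gives an indicator equal to 1 at
  -- `s` and 0 at `t`.
  obtain ⟨e, hse, he⟩ := exists_basic_subset (isOpen_compl_singleton (x := t)) hst
  refine ⟨indicator e, ⟨indicator e, hA e, rfl⟩, ?_⟩
  have hte : ¬ t.eval e = true := fun h => he h rfl
  rw [indicator_apply, indicator_apply, if_pos (show s.eval e = true from hse), if_neg hte]
  exact one_ne_zero

/-- Every continuous function is uniformly approximated by functions at which a given derivation
vanishes. -/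
theorem exists_norm_sub_lt_of_derivation {M : Type*} [AddCommGroup M] [Module ℝ M]
    [Module C(StoneSpace B, ℝ) M] (δ : Derivation ℝ C(StoneSpace B, ℝ) M)
    (x : C(StoneSpace B, ℝ)) {ε : ℝ} (hε : 0 < ε) :
    ∃ s : C(StoneSpace B, ℝ), δ s = 0 ∧ ‖s - x‖ < ε := by
  -- Stone–Weierstrass for the kernel; no topology on `M` enters.
  obtain ⟨s, hs⟩ := ContinuousMap.exists_mem_subalgebra_near_continuousMap_of_separatesPoints
    δ.kerSubalgebra (separatesPoints_of_indicator_mem fun e =>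
      δ.map_eq_zero_of_mul_self (indicator_mul_self e)) x ε hε
  exact ⟨s, s.2, hs⟩

end StoneSpace

/-! ### Lower bounds on a clopen set -/

open Classical in
theorem L0.idem_apply {B : Type u} [CompleteBooleanAlgebra B] (e : B) (t : StoneSpace B) :
    L0.idem e t = ((if t ∈ StoneSpace.basic e then 1 else 0 : ℝ) : EReal) := rfl

/-- A non-zero element of `L0 B` is bounded away from zero on a non-zero element of `B`. -/
theorem L0.exists_lt_abs_of_ne_zero {B : Type u} [CompleteBooleanAlgebra B] {y : L0 B}
    (hy : y ≠ 0) :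
    ∃ (c : ℝ) (q : B), 0 < c ∧ q ≠ ⊥ ∧ ∀ t ∈ StoneSpace.basic q, (c : EReal) < |y| t := by
  -- An element is determined by its finite values, so they cannot all be zero.
  have : ∃ t, ∃ r : ℝ, y t = r ∧ r ≠ 0 := by
    by_contra! h
    exact hy (CInfty.ext₁ y fun t r hr => by rw [CInfty.zero_apply, hr, h t r hr])
  obtain ⟨t, r, hr, hr0⟩ := this
  have hr' : 0 < |r| := abs_pos.2 hr0
  -- Halving `|r|` gives a strict inequality at `t`, which persists on a neighbourhood.
  have hU : IsOpen {s | ((|r| / 2 : ℝ) : EReal) < |y| s} :=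
    isOpen_lt continuous_const |y|.continuous_toFun
  have htU : t ∈ {s | ((|r| / 2 : ℝ) : EReal) < |y| s} := by
    show ((|r| / 2 : ℝ) : EReal) < |y| t
    rw [CInfty.abs_apply_of_eq hr, EReal.coe_lt_coe_iff]
    exact half_lt_self hr'
  obtain ⟨q, htq, hq⟩ := StoneSpace.exists_basic_subset hU htU
  refine ⟨|r| / 2, q, half_pos hr', ?_, fun s hs => hq hs⟩
  rintro rfl
  have h : t.eval ⊥ = true := htq
  rw [StoneSpace.eval_bot] at h
  exact Bool.false_ne_true h

/-- If `|y| ≥ c` on `Q(q)`, then `|(n / c) y| ≥ n q`. -/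
theorem L0.smul_idem_le_abs_smul {B : Type u} [CompleteBooleanAlgebra B] {y : L0 B} {c : ℝ}
    (hc : 0 < c) {q : B} (hq : ∀ t ∈ StoneSpace.basic q, (c : EReal) < |y| t) {d : ℝ}
    (hd : 0 ≤ d) : d • L0.idem q ≤ |(d / c) • y| := by
  -- Where `y` is finite, both sides are real numbers given by the pointwise formulas.
  refine CInfty.le_of_dense y.dense_finiteSet ?_
  rintro t ⟨r, hr⟩
  rw [CInfty.smul_apply d (L0.idem_apply q t), CInfty.abs_apply_of_eq (CInfty.smul_apply _ hr),
    EReal.coe_le_coe_iff]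
  split_ifs with ht
  · have h := hq t ht
    rw [CInfty.abs_apply_of_eq hr, EReal.coe_lt_coe_iff] at h
    rw [abs_mul, abs_of_nonneg (div_nonneg hd hc.le), div_mul_eq_mul_div, le_div_iff₀ hc, mul_one]
    exact mul_le_mul_of_nonneg_left h.le hd
  · rw [mul_zero]
    exact abs_nonneg _

theorem mainTheorem10 {B : Type u} [CompleteBooleanAlgebra B]
    (δ : Derivation ℝ C(StoneSpace B, ℝ) (L0 B)) (hδ : δ ≠ 0) :
    ∃ (a : ℕ → C(StoneSpace B, ℝ)) (q : B), q ≠ ⊥ ∧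
      ∀ n : ℕ, |a n| ≤ 1 ∧ (n : ℝ) • L0.idem q ≤ |δ (a n)| := by
  obtain ⟨x, hx⟩ : ∃ x, δ x ≠ 0 := by
    by_contra! h
    exact hδ (Derivation.ext h)
  obtain ⟨c, q, hc, hq, hcq⟩ := L0.exists_lt_abs_of_ne_zero hx
  -- The `+ 1` keeps the tolerance positive at `n = 0`; after scaling by `n / c` the bound is `n /
  -- (n + 1) ≤ 1`.
  have hε (n : ℕ) : 0 < c / (n + 1) := div_pos hc n.cast_add_one_pos
  choose s hs hsx using fun n : ℕ => StoneSpace.exists_norm_sub_lt_of_derivation δ x (hε n)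
  refine ⟨fun n => ((n : ℝ) / c) • (x - s n), q, hq, fun n => ⟨fun t => ?_, ?_⟩⟩
  · have h1 : |x t - s n t| ≤ c / (n + 1) := by
      have h := ((s n - x).norm_coe_le_norm t).trans (hsx n).le
      rwa [Real.norm_eq_abs, ContinuousMap.sub_apply, abs_sub_comm] at h
    show |(n : ℝ) / c * (x t - s n t)| ≤ 1
    have h0 : 0 ≤ (n : ℝ) / c := div_nonneg n.cast_nonneg hc.le
    rw [abs_mul, abs_of_nonneg h0]
    calc (n : ℝ) / c * |x t - s n t| ≤ n / c * (c / (n + 1)) := mul_le_mul_of_nonneg_left h1 h0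
      _ = n / (n + 1) := by field_simp
      _ ≤ 1 := (div_le_one n.cast_add_one_pos).2 (by linarith)
  -- Since `δ (s n) = 0`, the image of `a n` is exactly `(n / c) • δ x`.
  · rw [δ.map_smul, map_sub, hs, sub_zero]
    exact L0.smul_idem_le_abs_smul hc hcq n.cast_nonneg
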